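/- For a finite group $H$ let $F(H)$ be its Fitting subgroup (the largest nilpotent normal subgroup). Put $\nu_0(H)=F(H)$ and let $\nu_{i+1}(H)$ be the smallest subgroup of $\nu_i(H)$ that is normal in $F(H)$ and such that $\nu_i(H)/\nu_{i+1}(H)$ is a direct product of elementary abelian groups and is centralized by $F(H)$. The $F$-class of $H$ is the least $c$ with $\nu_c(H)=1$, and the $F$-rank of $H$ is $|\nu_0(H)/\nu_1(H)|$. Let $G$ be a finite group of $F$-class $c$, and let $k$ be the product of the distinct primes dividing the $F$-rank of $G$. Let $g_1,\dots,g_n$ be any generators of $G$, let $F$ be the free group on $f_1,\dots,f_n$, and let $\mu:F\to G$ be the homomorphism with $\mu(f_i)=g_i$. Let $R=\ker\mu$, let $L=\mu^{-1}(F(G))$, and let $K=[R,L]R^k$, where $R^k$ is the subgroup generated by the $k$-th powers of elements of $R$. Let $G^*=F/K$ be the corresponding covering group of $G$, with multiplicator $M=R/K$ and nucleus $N=\nu_c(G^*)$. A subgroup $U$ of $G^*$ is called allowable if $U$ is a proper subgroup of $M$, $U$ is normal in $G^*$, and $NU=M$. Let $\mathrm{Aut}_M(G^*)$ be the group of all automorphisms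 $\alpha$ of $G^*$ with $\alpha(M)=M$. Let $U_1,U_2$ be allowable subgroups of $G^*$. Then $G^*/U_1\cong G^*/U_2$ if and only if there exists $\alpha\in\mathrm{Aut}_M(G^*)$ with $\alpha(U_1)=U_2$. -/

import Mathlib

namespace FCentral

/-- The Fitting subgroup: the join of all nilpotent normal subgroups. For a finite group this
is the largest nilpotent normal subgroup. -/
def fitting (G : Type*) [Group G] : Subgroup G :=
  sSup {H : Subgroup G | H.Normal ∧ Group.IsNilpotent H}

/-- A (finite) direct product of elementary abelian groups. Every elementary abelian `p`-group is
a direct product of cyclic groups of order `p`, so such a group is a direct product of cyclic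
groups of prime order, the primes not necessarily being distinct. -/
def IsProdElementaryAbelian (Q : Type*) [Group Q] : Prop :=
  ∃ (ι : Type) (_ : Finite ι) (p : ι → ℕ),
    (∀ i, (p i).Prime) ∧ Nonempty (Q ≃* ((i : ι) → Multiplicative (ZMod (p i))))

/-- `S` is a subgroup of `H`, normal in the Fitting subgroup `F`, such that `H / S` is
a direct product of elementary abelian groups and is centralized by `F`. -/
def IsFCentralStep {G : Type*} [Group G] (H S : Subgroup G) : Prop :=
  S ≤ H ∧ (S.subgroupOf (fitting G)).Normal ∧
    (∃ _ : (S.subgroupOf H).Normal, IsProdElementaryAbelian (H ⧸ S.subgroupOf H)) ∧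
    ⁅fitting G, H⁆ ≤ S

/-- The terms `ν_i(G)` of the `F`-central series: `ν_0(G)` is the Fitting subgroup and
`ν_{i+1}(G)` is the smallest `S` with `IsFCentralStep (ν_i(G)) S`. -/
def nu (G : Type*) [Group G] : ℕ → Subgroup G
  | 0 => fitting G
  | i + 1 => sInf {S : Subgroup G | IsFCentralStep (nu G i) S}

/-- The `F`-class: the smallest `c` with `ν_c(G) = 1`. -/
noncomputable def fClass (G : Type*) [Group G] : ℕ :=
  sInf {c : ℕ | nu G c = ⊥}

/-- The `F`-rank: the order of `ν_0(G) / ν_1(G)`. -/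
noncomputable def fRank (G : Type*) [Group G] : ℕ :=
  (nu G 1).relIndex (nu G 0)

/-- `H^k`: the subgroup generated by the `k`-th powers of the elements of `H`. -/
def powerSubgroup {G : Type*} [Group G] (H : Subgroup G) (k : ℕ) : Subgroup G :=
  Subgroup.closure ((fun x => x ^ k) '' (H : Set G))

theorem fitting_normal (G : Type*) [Group G] : (fitting G).Normal := by
  exact Subgroup.sSup_normal _ fun _ hH => hH.1

theorem powerSubgroup_normal {G : Type*} [Group G] (H : Subgroup G) (hH : H.Normal) (k : ℕ) :
    (powerSubgroup H k).Normal := by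
  refine ⟨fun x hx g => ?_⟩
  suffices h : powerSubgroup H k ≤ (powerSubgroup H k).comap (MulAut.conj g).toMonoidHom from h hx
  refine (Subgroup.closure_le _).2 ?_
  rintro _ ⟨y, hy, rfl⟩
  refine Subgroup.subset_closure ⟨g * y * g⁻¹, hH.conj_mem y hy g, ?_⟩
  simp [conj_pow]

section Covering

variable {G : Type*} [Group G] {n : ℕ}

/-- The presentation homomorphism `μ : F → G`, `f_i ↦ g_i`, on the free group of rank `n`. -/
def presentation (g : Fin n → G) : FreeGroup (Fin n) →* G :=
  FreeGroup.lift g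

/-- `K = [R, L] R^k`, where `R = ker μ`, `L` is the full preimage of the Fitting subgroup
and `k` is the product of the distinct primes dividing the `F`-rank of `G`. -/
noncomputable def coveringKernel (g : Fin n → G) : Subgroup (FreeGroup (Fin n)) :=
  ⁅(presentation g).ker, (fitting G).comap (presentation g)⁆ ⊔
    powerSubgroup (presentation g).ker (UniqueFactorizationMonoid.radical (fRank G))

instance coveringKernel_normal (g : Fin n → G) : (coveringKernel g).Normal := by
  have h₁ : ((fitting G).comap (presentation g)).Normal := (fitting_normal G).comap _
  have h₂ := powerSubgroup_normal (presentation g).ker inferInstance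
    (UniqueFactorizationMonoid.radical (fRank G))
  unfold coveringKernel
  infer_instance

/-- The covering group `G* = F / K` belonging to the generating tuple `g`. -/
abbrev CoveringGroup (g : Fin n → G) : Type :=
  FreeGroup (Fin n) ⧸ coveringKernel g

/-- The multiplicator `M = R / K`. -/
noncomputable def multiplicator (g : Fin n → G) : Subgroup (CoveringGroup g) :=
  (presentation g).ker.map (QuotientGroup.mk' (coveringKernel g))

/-- The nucleus `N = ν_c(G*)`, where `c` is the `F`-class of `G`. -/
noncomputable def nucleus (g : Fin n → G) : Subgroup (CoveringGroup g) :=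
  nu (CoveringGroup g) (fClass G)

/-- Allowable subgroups: proper subgroups `U` of `M`, normal in `G*`, with `N U = M`. -/
structure IsAllowable (g : Fin n → G) (U : Subgroup (CoveringGroup g)) : Prop where
  normal : U.Normal
  lt_multiplicator : U < multiplicator g
  nucleus_sup : nucleus g ⊔ U = multiplicator g

/-- `Aut_M(G*)`: the group of automorphisms of `G*` that leave `M` setwise invariant. -/
def autM (g : Fin n → G) : Subgroup (MulAut (CoveringGroup g)) where
  carrier := {α | (multiplicator g).map α.toMonoidHom = multiplicator g}
  one_mem' := Subgroup.map_id _
  mul_mem' {α β} hα hβ := by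
    have h : (α * β).toMonoidHom = α.toMonoidHom.comp β.toMonoidHom := rfl
    change (multiplicator g).map (α * β).toMonoidHom = multiplicator g
    rw [h, ← Subgroup.map_map, hβ, hα]
  inv_mem' {α} hα := by
    have h : (α⁻¹).toMonoidHom.comp α.toMonoidHom = MonoidHom.id _ := by
      refine MonoidHom.ext fun x => ?_
      exact α.symm_apply_apply x
    change (multiplicator g).map (α⁻¹).toMonoidHom = multiplicator g
    replace hα : (multiplicator g).map α.toMonoidHom = multiplicator g := hα
    conv_lhs => rw [← hα]
    rw [Subgroup.map_map, h, Subgroup.map_id]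

end Covering

end FCentral

/-!
Put `F = FreeGroup (Fin n)`. Two surjections `β, γ : G* → Q` whose kernels are allowable pull the
subgroup `ν_c(Q)` back to the same subgroup `M`, because `M = N U` for allowable `U` and the
`F`-central series is compatible with surjections; they also pull the Fitting subgroup of `Q` back
to that of `G*`, because `M` commutes with the preimage of the Fitting subgroup. By Gaschütz's lemma
the homomorphism `F → G* → Q` built from `β` lifts along `γ` to a *surjection* `θ : F → G*`. The two
pullback identities show `θ⁻¹(M) = R` and `θ⁻¹(Fit G*) = L`, so `θ` kills `K = [R, L] R^k` and
induces a surjective endomorphism of the finite group `G*`, which is the required automorphism.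
-/

namespace FCentral

open UniqueFactorizationMonoid (radical)

section ElementaryAbelian

variable {Q : Type*} [Group Q]

theorem IsProdElementaryAbelian.squarefree_exponent (h : IsProdElementaryAbelian Q) :
    Squarefree (Monoid.exponent Q) := by
  obtain ⟨ι, hι, p, hp, ⟨e⟩⟩ := h
  have := Fintype.ofFinite ι
  have hprod : ∏ i, p i ≠ 0 := Finset.prod_ne_zero_iff.2 fun i _ => (hp i).ne_zero
  suffices hdvd : Monoid.exponent Q ∣ radical (∏ i, p i) from
    UniqueFactorizationMonoid.squarefree_radical.squarefree_of_dvd hdvd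
  rw [Monoid.exponent_eq_of_mulEquiv e, Monoid.exponent_pi]
  refine Finset.lcm_dvd fun i hi => ?_
  rw [Monoid.exponent_multiplicative, ZMod.exponent]
  exact (UniqueFactorizationMonoid.dvd_radical_iff_of_irreducible (hp i) hprod).2
    (Finset.dvd_prod_of_mem p hi)

theorem bijective_restrict_of_subsingleton {ι : Type*} {M : ι → Type*} [∀ i, Nonempty (M i)]
    {p : ι → Prop} (h : ∀ i, ¬ p i → Subsingleton (M i)) :
    Function.Bijective fun x : ∀ i, M i => Subtype.restrict p x := by
  refine ⟨fun x y hxy => funext fun i => ?_, Subtype.surjective_restrict p⟩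
  by_cases hi : p i
  · exact congrFun hxy ⟨i, hi⟩
  · have := h i hi
    exact Subsingleton.elim _ _

open scoped IsMulCommutative in
theorem IsProdElementaryAbelian.of_squarefree_exponent [Finite Q] [IsMulCommutative Q]
    (h : Squarefree (Monoid.exponent Q)) : IsProdElementaryAbelian Q := by
  obtain ⟨ι, _, p, hp, n, ⟨e⟩⟩ := AddCommGroup.equiv_directSum_zmod_of_finite (Additive Q)
  let M : ι → Type := fun i => Multiplicative (ZMod (p i ^ n i))
  let e' : Q ≃* ∀ i, M i := MulEquiv.toAdditive.symm <| e.trans <|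
    (DirectSum.addEquivProd _).trans (MulEquiv.piMultiplicative _).toAdditiveRight
  have hprime : ∀ i, n i ≠ 0 → (p i ^ n i).Prime := fun i hi => by
    have hdvd : p i ^ n i ∣ Monoid.exponent Q := by
      have := MonoidHom.exponent_dvd (f := (Pi.evalMonoidHom M i).comp e'.toMonoidHom)
        ((Function.surjective_eval i).comp e'.surjective)
      rwa [Monoid.exponent_multiplicative, ZMod.exponent] at this
    have hn : n i = 1 :=
      ((Nat.squarefree_pow_iff (hp i).ne_one hi).1 (h.squarefree_of_dvd hdvd)).2
    rw [hn, pow_one]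
    exact hp i
  have hrestrict := bijective_restrict_of_subsingleton (M := M) (p := fun i => n i ≠ 0)
    fun i hi => by
      rw [not_not] at hi
      have : Subsingleton (ZMod (p i ^ n i)) := ZMod.subsingleton_iff.2 (by rw [hi, pow_zero])
      exact inferInstanceAs (Subsingleton (Multiplicative _))
  let r : (∀ i, M i) →* ∀ i : {i // n i ≠ 0}, M i := MonoidHom.pi fun i => Pi.evalMonoidHom M i.1
  exact ⟨_, inferInstance, fun i : {i // n i ≠ 0} => p i ^ n i, fun i => hprime i i.2,
    ⟨e'.trans (MulEquiv.ofBijective r hrestrict)⟩⟩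

end ElementaryAbelian

section PowerSubgroup

variable {A B : Type*} [Group A] [Group B]

theorem powerSubgroup_le_iff {H S : Subgroup A} {k : ℕ} :
    powerSubgroup H k ≤ S ↔ ∀ x ∈ H, x ^ k ∈ S := by
  rw [powerSubgroup, Subgroup.closure_le, Set.image_subset_iff]
  rfl

theorem powerSubgroup_le (H : Subgroup A) (k : ℕ) : powerSubgroup H k ≤ H :=
  powerSubgroup_le_iff.2 fun _ hx => pow_mem hx k

theorem map_powerSubgroup (f : A →* B) (H : Subgroup A) (k : ℕ) :
    (powerSubgroup H k).map f = powerSubgroup (H.map f) k := by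
  simp only [powerSubgroup, MonoidHom.map_closure, Subgroup.coe_map, Set.image_image, map_pow]

theorem exponent_quotient_subgroupOf_dvd_iff {H S : Subgroup A} [(S.subgroupOf H).Normal] {k : ℕ} :
    Monoid.exponent (H ⧸ S.subgroupOf H) ∣ k ↔ powerSubgroup H k ≤ S := by
  rw [Monoid.exponent_dvd_iff_forall_pow_eq_one, powerSubgroup_le_iff,
    (QuotientGroup.mk_surjective).forall, Subtype.forall]
  refine forall₂_congr fun x hx => ?_
  rw [← QuotientGroup.mk_pow, QuotientGroup.eq_one_iff, Subgroup.mem_subgroupOf]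
  rfl

end PowerSubgroup

section FCentralSeries

variable {A B : Type*} [Group A] [Group B]

theorem normal_subgroupOf_of_commutator_le {F H S : Subgroup A} (hS : S ≤ H) (h : ⁅F, H⁆ ≤ S) :
    (S.subgroupOf F).Normal :=
  Subgroup.normal_subgroupOf_of_le_normalizer <| Subgroup.le_normalizer_iff_commutator_le_right.2 <|
    (Subgroup.commutator_mono le_rfl hS).trans h

theorem isMulCommutative_quotient_subgroupOf {H S : Subgroup A} [(S.subgroupOf H).Normal]
    (h : ⁅H, H⁆ ≤ S) : IsMulCommutative (H ⧸ S.subgroupOf H) := by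
  rwa [Subgroup.Normal.quotient_commutative_iff_commutator_le, Subgroup.subgroupOf,
    ← Subgroup.map_le_iff_le_comap, Subgroup.map_subtype_commutator]

theorem isFCentralStep_iff {H S : Subgroup A} [Finite H] (hH : H ≤ fitting A) {m : ℕ} (hm : m ≠ 0)
    (hexp : Monoid.exponent H ∣ m) :
    IsFCentralStep H S ↔ S ≤ H ∧ ⁅fitting A, H⁆ ⊔ powerSubgroup H (radical m) ≤ S := by
  rw [sup_le_iff]
  constructor
  · rintro ⟨hS, -, ⟨hnormal, hQ⟩, hcomm⟩
    refine ⟨hS, hcomm, exponent_quotient_subgroupOf_dvd_iff.1 ?_⟩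
    exact (UniqueFactorizationMonoid.dvd_radical_iff hQ.squarefree_exponent.isRadical hm).2
      ((Group.exponent_quotient_dvd _).trans hexp)
  · rintro ⟨hS, hcomm, hpow⟩
    have hcommH : ⁅H, H⁆ ≤ S := (Subgroup.commutator_mono hH le_rfl).trans hcomm
    have hnormal : (S.subgroupOf H).Normal := normal_subgroupOf_of_commutator_le hS hcommH
    have := isMulCommutative_quotient_subgroupOf hcommH
    refine ⟨hS, normal_subgroupOf_of_commutator_le hS hcomm, ⟨hnormal, ?_⟩, hcomm⟩
    exact .of_squarefree_exponent <| UniqueFactorizationMonoid.squarefree_radical.squarefree_of_dvd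
      (exponent_quotient_subgroupOf_dvd_iff.2 hpow)

theorem sInf_isFCentralStep {H : Subgroup A} [Finite H] (hH : H ≤ fitting A)
    (hcomm : ⁅fitting A, H⁆ ≤ H) {m : ℕ} (hm : m ≠ 0) (hexp : Monoid.exponent H ∣ m) :
    sInf {S : Subgroup A | IsFCentralStep H S} =
      ⁅fitting A, H⁆ ⊔ powerSubgroup H (radical m) := by
  have hIcc : {S : Subgroup A | IsFCentralStep H S} =
      Set.Icc (⁅fitting A, H⁆ ⊔ powerSubgroup H (radical m)) H := by
    ext S
    rw [Set.mem_ofPred_eq, isFCentralStep_iff hH hm hexp, Set.mem_Icc, and_comm]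
  rw [hIcc, csInf_Icc (sup_le hcomm (powerSubgroup_le H _))]

theorem nu_normal_and_le_fitting (A : Type*) [Group A] [Finite A] (i : ℕ) :
    (nu A i).Normal ∧ nu A i ≤ fitting A := by
  have hfit := fitting_normal A
  induction i with
  | zero => exact ⟨hfit, le_rfl⟩
  | succ i ih =>
    obtain ⟨hnormal, hle⟩ := ih
    have hcomm := Subgroup.commutator_le_right (fitting A) (nu A i)
    rw [nu, sInf_isFCentralStep hle hcomm Monoid.exponent_ne_zero_of_finite dvd_rfl]
    have := powerSubgroup_normal (nu A i) hnormal (radical (Monoid.exponent (nu A i)))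
    exact ⟨inferInstance, sup_le (hcomm.trans hle) ((powerSubgroup_le _ _).trans hle)⟩

theorem nu_succ [Finite A] {m : ℕ} (hm : m ≠ 0) (hexp : Monoid.exponent A ∣ m) (i : ℕ) :
    nu A (i + 1) = ⁅fitting A, nu A i⁆ ⊔ powerSubgroup (nu A i) (radical m) := by
  obtain ⟨hnormal, hle⟩ := nu_normal_and_le_fitting A i
  exact sInf_isFCentralStep hle (Subgroup.commutator_le_right _ _) hm
    ((Monoid.exponent_submonoid_dvd (nu A i).toSubmonoid).trans hexp)

theorem map_nu [Finite A] [Finite B] {f : A →* B} (hf : (fitting A).map f = fitting B) (i : ℕ) :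
    (nu A i).map f = nu B i := by
  have hm : Monoid.exponent A * Monoid.exponent B ≠ 0 :=
    mul_ne_zero Monoid.exponent_ne_zero_of_finite Monoid.exponent_ne_zero_of_finite
  induction i with
  | zero => exact hf
  | succ i ih =>
    rw [nu_succ hm (dvd_mul_right _ _), nu_succ hm (dvd_mul_left _ _), Subgroup.map_sup,
      Subgroup.map_commutator, map_powerSubgroup, hf, ih]

end FCentralSeries

section Fitting

variable {A B C : Type*} [Group A] [Group B] [Group C]

theorem le_fitting {H : Subgroup A} (hnormal : H.Normal) (hnil : Group.IsNilpotent H) :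
    H ≤ fitting A :=
  le_sSup ⟨hnormal, hnil⟩

theorem map_fitting_le {f : A →* B} (hf : Function.Surjective f) :
    (fitting A).map f ≤ fitting B := by
  refine Subgroup.map_le_iff_le_comap.2 (sSup_le fun H ⟨hnormal, hnil⟩ => ?_)
  exact Subgroup.map_le_iff_le_comap.1 <| le_fitting (hnormal.map f hf)
    (Group.nilpotent_of_surjective (f.subgroupMap H) (f.subgroupMap_surjective H))

theorem isNilpotent_comap {f : A →* B} {H : Subgroup B} (hH : Group.IsNilpotent H)
    (hcentral : ⁅f.ker, H.comap f⁆ = ⊥) : Group.IsNilpotent (H.comap f) := by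
  refine Subgroup.isNilpotent_of_ker_le_center (f.subgroupComap H) fun x hx => ?_
  have hxker : (x : A) ∈ f.ker := congrArg Subtype.val (MonoidHom.mem_ker.1 hx)
  have hxcentral := Subgroup.commutator_eq_bot_iff_le_centralizer.1 hcentral hxker
  exact Subgroup.mem_center_iff.2 fun y =>
    Subtype.ext (Subgroup.mem_centralizer_iff.1 hxcentral y y.2)

theorem comap_fitting {f : A →* B} (hf : Function.Surjective f)
    (hcentral : ⁅f.ker, (fitting B).comap f⁆ = ⊥) : (fitting B).comap f = fitting A := by
  have comap_le : ∀ H : Subgroup B, H.Normal → Group.IsNilpotent H → H.comap f ≤ fitting A := by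
    refine fun H hnormal hnil => le_fitting (hnormal.comap f) (isNilpotent_comap hnil ?_)
    exact le_bot_iff.1 <| hcentral.le.trans' <|
      Subgroup.commutator_mono le_rfl (Subgroup.comap_mono (le_fitting hnormal hnil))
  have hker : f.ker ≤ fitting A := comap_le ⊥ inferInstance inferInstance
  refine le_antisymm ?_ (Subgroup.map_le_iff_le_comap.1 (map_fitting_le hf))
  rw [← Subgroup.comap_map_eq_self hker]
  refine Subgroup.comap_mono (sSup_le fun H ⟨hnormal, hnil⟩ => ?_)
  rw [← Subgroup.map_comap_eq_self_of_surjective hf H]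
  exact Subgroup.map_mono (comap_le H hnormal hnil)

theorem comap_fitting_of_ker_le {f : A →* B} (hf : Function.Surjective f) {h : A →* C}
    (hh : Function.Surjective h) (hker : f.ker ≤ h.ker)
    (hcentral : ⁅h.ker, (fitting C).comap h⁆ = ⊥) : (fitting B).comap f = fitting A := by
  let q : B →* C := f.liftOfSurjective hf ⟨h, hker⟩
  have hqf : q.comp f = h := 
    f.liftOfRightInverse_comp _ (Function.rightInverse_surjInv hf) ⟨h, hker⟩
  have hq : Function.Surjective q := .of_comp (g := f) (by rwa [← MonoidHom.coe_comp, hqf])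
  refine comap_fitting hf (le_bot_iff.1 <| hcentral.le.trans' <| Subgroup.commutator_mono hker ?_)
  rw [← hqf, ← Subgroup.comap_comap]
  exact Subgroup.comap_mono (Subgroup.map_le_iff_le_comap.1 (map_fitting_le hq))

end Fitting

section Gaschutz

theorem card_le_eq_card_lt_add_card_eq {α P : Type*} [Finite α] [PartialOrder P] (u : α → P)
    (p : P) :
    Nat.card {a // u a ≤ p} = Nat.card {a // u a < p} + Nat.card {a // u a = p} := by
  classical
  rw [← Nat.card_sum, ← Nat.card_congr (subtypeOrEquiv _ _ ?_)]
  · simp only [le_iff_lt_or_eq]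
  · exact Pi.disjoint_iff.2 fun a => Prop.disjoint_iff.2 <| not_and.2 ne_of_lt

theorem card_eq_of_card_le_eq {α β P : Type*} [Finite α] [Finite β] [PartialOrder P]
    [WellFoundedLT P] {u : α → P} {v : β → P}
    (h : ∀ p, Nat.card {a // u a ≤ p} = Nat.card {b // v b ≤ p}) (p : P) :
    Nat.card {a // u a = p} = Nat.card {b // v b = p} := by
  induction p using WellFoundedLT.induction with
  | ind p ih =>
    have fiberEquiv : ∀ q : {q // q < p}, Nonempty ({a // u a = q} ≃ {b // v b = q}) :=
      fun q => Finite.card_eq.1 (ih q q.2)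
    have hlt : Nat.card {a // u a < p} = Nat.card {b // v b < p} := Nat.card_congr <|
      (Equiv.sigmaSubtypeFiberEquivSubtype u fun _ => Iff.rfl).symm.trans <|
        (Equiv.sigmaCongrRight fun q => (fiberEquiv q).some).trans <|
          Equiv.sigmaSubtypeFiberEquivSubtype v fun _ => Iff.rfl
    have hle := h p
    rw [card_le_eq_card_lt_add_card_eq, card_le_eq_card_lt_add_card_eq, hlt] at hle
    exact Nat.add_left_cancel hle

variable {A B ι : Type*} [Group A] [Group B]

theorem closure_range_le_iff {x : ι → A} {H : Subgroup A} :
    Subgroup.closure (Set.range x) ≤ H ↔ ∀ i, x i ∈ H := by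
  rw [Subgroup.closure_le, Set.range_subset_iff]
  rfl

theorem card_lifts_le_eq (f : A →* B) {s t : ι → B}
    (hst : Subgroup.closure (Set.range s) = Subgroup.closure (Set.range t)) (H : Subgroup A) :
    Nat.card {x : {x : ι → A // f ∘ x = s} // Subgroup.closure (Set.range x.1) ≤ H} =
      Nat.card {x : {x : ι → A // f ∘ x = t} // Subgroup.closure (Set.range x.1) ≤ H} := by
  by_cases hs : ∀ i, s i ∈ H.map f
  · have ht : ∀ i, t i ∈ H.map f := by rwa [← closure_range_le_iff, ← hst, closure_range_le_iff]
    choose a haH ha using fun i => Subgroup.mem_map.1 (mul_mem (ht i) (inv_mem (hs i)))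
    let translate : {x : ι → A // f ∘ x = s} ≃ {x : ι → A // f ∘ x = t} :=
      (Equiv.mulLeft a).subtypeEquiv fun x => by
        simp only [funext_iff, Function.comp_apply, Equiv.coe_mulLeft, Pi.mul_apply, map_mul, ha,
          mul_assoc, mul_eq_left, inv_mul_eq_one]
        exact forall_congr' fun i => eq_comm
    refine Nat.card_congr (translate.subtypeEquiv fun x => ?_)
    simp only [closure_range_le_iff]
    exact forall_congr' fun i => (H.mul_mem_cancel_left (haH i)).symm
  · have no_lift : ∀ r : ι → B, (¬ ∀ i, r i ∈ H.map f) →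
        IsEmpty {x : {x : ι → A // f ∘ x = r} // Subgroup.closure (Set.range x.1) ≤ H} := by
      rintro r hr
      refine ⟨fun ⟨⟨x, hx⟩, hxH⟩ => hr fun i => ?_⟩
      exact ⟨x i, closure_range_le_iff.1 hxH i, congrFun hx i⟩
    have := no_lift s hs
    have := no_lift t (by rwa [← closure_range_le_iff, ← hst, closure_range_le_iff])
    rw [Nat.card_of_isEmpty, Nat.card_of_isEmpty]

/-- **Gaschütz's lemma**. The number of lifts of a tuple `t` that generate a given subgroup depends
only on the subgroup generated by `t`, and `a` itself is a lift of `f ∘ a`. -/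
theorem exists_lift_closure_range_eq [Finite A] [Finite ι] (f : A →* B) {a : ι → A} {t : ι → B}
    (ht : Subgroup.closure (Set.range t) = Subgroup.closure (Set.range (f ∘ a))) :
    ∃ x : ι → A, f ∘ x = t ∧ Subgroup.closure (Set.range x) = Subgroup.closure (Set.range a) := by
  have : Nonempty {x : {x : ι → A // f ∘ x = f ∘ a} //
      Subgroup.closure (Set.range x.1) = Subgroup.closure (Set.range a)} := ⟨⟨a, rfl⟩, rfl⟩
  have hpos : 0 < Nat.card {x : {x : ι → A // f ∘ x = t} //
      Subgroup.closure (Set.range x.1) = Subgroup.closure (Set.range a)} := by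
    rw [card_eq_of_card_le_eq (card_lifts_le_eq f ht)]
    exact Nat.card_pos
  obtain ⟨⟨⟨x, hxt⟩, hx⟩⟩ := (Nat.card_pos_iff.1 hpos).1
  exact ⟨x, hxt, hx⟩

theorem closure_range_comp_of (ψ : FreeGroup ι →* A) :
    Subgroup.closure (Set.range (ψ ∘ FreeGroup.of)) = ψ.range := by
  rw [Set.range_comp, ← MonoidHom.map_closure, FreeGroup.closure_range_of, MonoidHom.range_eq_map]

theorem exists_surjective_freeGroup_lift [Finite A] [Finite ι] {π : FreeGroup ι →* A}
    (hπ : Function.Surjective π) (f : A →* B) {φ : FreeGroup ι →* B} (hφ : φ.range = f.range) :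
    ∃ θ : FreeGroup ι →* A, Function.Surjective θ ∧ f.comp θ = φ := by
  have hgen : Subgroup.closure (Set.range (φ ∘ FreeGroup.of)) =
      Subgroup.closure (Set.range (f ∘ π ∘ FreeGroup.of)) := by
    rw [← Function.comp_assoc, ← MonoidHom.coe_comp, closure_range_comp_of, closure_range_comp_of,
      hφ, MonoidHom.range_comp, MonoidHom.range_eq_top.2 hπ, MonoidHom.range_eq_map]
  obtain ⟨x, hfx, hx⟩ := exists_lift_closure_range_eq f hgen
  refine ⟨FreeGroup.lift x, ?_, FreeGroup.ext_hom _ _ fun i => ?_⟩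
  · rw [← MonoidHom.range_eq_top, FreeGroup.range_lift_eq_closure, hx, closure_range_comp_of,
      MonoidHom.range_eq_top.2 hπ]
  · rw [MonoidHom.comp_apply, FreeGroup.lift_apply_of]
    exact congrFun hfx i

end Gaschutz

section Covering

variable {G : Type*} [Group G] {n : ℕ}

theorem presentation_surjective {g : Fin n → G} (hg : Subgroup.closure (Set.range g) = ⊤) :
    Function.Surjective (presentation g) := by
  rw [← MonoidHom.range_eq_top, presentation, FreeGroup.range_lift_eq_closure, hg]

theorem coveringKernel_le_iff {g : Fin n → G} {N : Subgroup (FreeGroup (Fin n))} :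
    coveringKernel g ≤ N ↔
      ⁅(presentation g).ker, (fitting G).comap (presentation g)⁆ ≤ N ∧
        ∀ x ∈ (presentation g).ker, x ^ radical (fRank G) ∈ N := by
  rw [coveringKernel, sup_le_iff, powerSubgroup_le_iff]

theorem coveringKernel_le_ker (g : Fin n → G) : coveringKernel g ≤ (presentation g).ker := by
  have := (fitting_normal G).comap (presentation g)
  exact coveringKernel_le_iff.2 ⟨Subgroup.commutator_le_left _ _, fun _ hx => pow_mem hx _⟩

/-- The natural projection `G* = F / K → F / R = G`. -/
noncomputable def coveringProj (g : Fin n → G) : CoveringGroup g →* G :=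
  QuotientGroup.lift (coveringKernel g) (presentation g) (coveringKernel_le_ker g)

theorem coveringProj_comp_mk (g : Fin n → G) :
    (coveringProj g).comp (QuotientGroup.mk' (coveringKernel g)) = presentation g := rfl

theorem coveringProj_surjective {g : Fin n → G} (hg : Subgroup.closure (Set.range g) = ⊤) :
    Function.Surjective (coveringProj g) :=
  QuotientGroup.lift_surjective_of_surjective _ _ (presentation_surjective hg) _

theorem comap_mk_multiplicator (g : Fin n → G) :
    (multiplicator g).comap (QuotientGroup.mk' (coveringKernel g)) = (presentation g).ker := by
  rw [multiplicator, Subgroup.comap_map_eq_self]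
  rw [QuotientGroup.ker_mk']
  exact coveringKernel_le_ker g

theorem ker_coveringProj (g : Fin n → G) : (coveringProj g).ker = multiplicator g := by
  refine Subgroup.comap_injective (QuotientGroup.mk'_surjective (coveringKernel g)) ?_
  rw [comap_mk_multiplicator, MonoidHom.comap_ker, coveringProj_comp_mk]

theorem commutator_multiplicator_eq_bot (g : Fin n → G) :
    ⁅multiplicator g, (fitting G).comap (coveringProj g)⁆ = ⊥ := by
  rw [multiplicator, ← Subgroup.map_comap_eq_self_of_surjective (QuotientGroup.mk'_surjective _)
    ((fitting G).comap (coveringProj g)), Subgroup.comap_comap, coveringProj_comp_mk,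
    ← Subgroup.map_commutator, Subgroup.map_eq_bot_iff, QuotientGroup.ker_mk']
  exact (coveringKernel_le_iff.1 le_rfl).1

theorem pow_eq_one_of_mem_multiplicator {g : Fin n → G} {x : CoveringGroup g}
    (hx : x ∈ multiplicator g) : x ^ radical (fRank G) = 1 := by
  obtain ⟨y, hy, rfl⟩ := hx
  rw [← map_pow, ← MonoidHom.mem_ker, QuotientGroup.ker_mk']
  exact (coveringKernel_le_iff.1 le_rfl).2 y hy

instance isMulCommutative_multiplicator (g : Fin n → G) : IsMulCommutative (multiplicator g) := by
  rw [← Subgroup.le_centralizer_iff_isMulCommutative,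
    ← Subgroup.commutator_eq_bot_iff_le_centralizer, ← le_bot_iff,
    ← commutator_multiplicator_eq_bot g]
  refine Subgroup.commutator_mono le_rfl ?_
  rw [← ker_coveringProj]
  exact MonoidHom.ker_le_comap _ _

open scoped IsMulCommutative in
instance finite_multiplicator [Finite G] (g : Fin n → G) : Finite (multiplicator g) := by
  have : Group.FG (presentation g).ker := Subgroup.fg_of_index_ne_zero _
  have : Group.FG (multiplicator g) :=
    Group.fg_of_surjective (MonoidHom.subgroupMap_surjective (QuotientGroup.mk' _) _)
  refine CommGroup.finite_of_fg_isMulTorsion _ fun x => isOfFinOrder_iff_pow_eq_one.2 ?_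
  exact ⟨_, Nat.pos_of_ne_zero UniqueFactorizationMonoid.radical_ne_zero,
    Subtype.ext (pow_eq_one_of_mem_multiplicator x.2)⟩

instance finite_coveringGroup [Finite G] (g : Fin n → G) : Finite (CoveringGroup g) := by
  have : Finite (coveringProj g).ker := by
    rw [ker_coveringProj]
    infer_instance
  have : Finite (CoveringGroup g ⧸ (coveringProj g).ker) :=
    Finite.of_equiv _ (QuotientGroup.quotientKerEquivRange (coveringProj g)).symm.toEquiv
  exact Finite.of_subgroup_quotient (coveringProj g).ker

variable {g : Fin n → G} {Q : Type*} [Group Q]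

theorem comap_coveringProj_fitting (hg : Subgroup.closure (Set.range g) = ⊤) :
    (fitting G).comap (coveringProj g) = fitting (CoveringGroup g) := by
  refine comap_fitting (coveringProj_surjective hg) ?_
  rw [ker_coveringProj, commutator_multiplicator_eq_bot]

theorem comap_mk_fitting (hg : Subgroup.closure (Set.range g) = ⊤) :
    (fitting (CoveringGroup g)).comap (QuotientGroup.mk' (coveringKernel g)) =
      (fitting G).comap (presentation g) := by
  rw [← comap_coveringProj_fitting hg, Subgroup.comap_comap, coveringProj_comp_mk]

theorem IsAllowable.comap_fitting (hg : Subgroup.closure (Set.range g) = ⊤)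
    {f : CoveringGroup g →* Q} (hf : Function.Surjective f) (hker : IsAllowable g f.ker) :
    (fitting Q).comap f = fitting (CoveringGroup g) := by
  refine comap_fitting_of_ker_le hf (coveringProj_surjective hg) ?_ ?_
  · rw [ker_coveringProj]
    exact hker.lt_multiplicator.le
  · rw [ker_coveringProj, commutator_multiplicator_eq_bot]

theorem IsAllowable.comap_nu [Finite G] (hg : Subgroup.closure (Set.range g) = ⊤)
    {f : CoveringGroup g →* Q} (hf : Function.Surjective f) (hker : IsAllowable g f.ker) :
    (nu Q (fClass G)).comap f = multiplicator g := by
  have := Finite.of_surjective f hf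
  have hfit : (fitting (CoveringGroup g)).map f = fitting Q := by
    rw [← hker.comap_fitting hg hf, Subgroup.map_comap_eq_self_of_surjective hf]
  rw [← map_nu hfit, Subgroup.comap_map_eq]
  exact hker.nucleus_sup

theorem coveringKernel_le_ker_of_comap_eq (hg : Subgroup.closure (Set.range g) = ⊤)
    {θ : FreeGroup (Fin n) →* CoveringGroup g}
    (hM : (multiplicator g).comap θ = (presentation g).ker)
    (hfit : (fitting (CoveringGroup g)).comap θ = (fitting G).comap (presentation g)) :
    coveringKernel g ≤ θ.ker := by
  refine coveringKernel_le_iff.2 ⟨?_, fun x hx => ?_⟩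
  · rw [← hM, ← hfit, ← comap_coveringProj_fitting hg, ← Subgroup.map_eq_bot_iff,
      Subgroup.map_commutator, ← le_bot_iff, ← commutator_multiplicator_eq_bot g]
    exact Subgroup.commutator_mono (Subgroup.map_comap_le _ _) (Subgroup.map_comap_le _ _)
  · rw [← hM] at hx
    rw [MonoidHom.mem_ker, map_pow, pow_eq_one_of_mem_multiplicator hx]

theorem exists_surjective_endomorphism [Finite G] (hg : Subgroup.closure (Set.range g) = ⊤)
    {β γ : CoveringGroup g →* Q} (hβ : Function.Surjective β) (hγ : Function.Surjective γ)
    (hkerβ : IsAllowable g β.ker) (hkerγ : IsAllowable g γ.ker) :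
    ∃ α : CoveringGroup g →* CoveringGroup g, Function.Surjective α ∧ γ.comp α = β := by
  let π := QuotientGroup.mk' (coveringKernel g)
  have hπ : Function.Surjective π := QuotientGroup.mk'_surjective _
  obtain ⟨θ, hθ, hγθ⟩ : ∃ θ : FreeGroup (Fin n) →* CoveringGroup g,
      Function.Surjective θ ∧ γ.comp θ = β.comp π := by
    have hβπ : Function.Surjective (β.comp π) := hβ.comp hπ
    refine exists_surjective_freeGroup_lift hπ γ ?_
    rw [MonoidHom.range_eq_top.2 hγ, MonoidHom.range_eq_top.2 hβπ]
  have hM : (multiplicator g).comap θ = (presentation g).ker := by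
    rw [← hkerγ.comap_nu hg hγ, Subgroup.comap_comap, hγθ, ← Subgroup.comap_comap,
      hkerβ.comap_nu hg hβ, comap_mk_multiplicator]
  have hfit : (fitting (CoveringGroup g)).comap θ = (fitting G).comap (presentation g) := by
    rw [← hkerγ.comap_fitting hg hγ, Subgroup.comap_comap, hγθ, ← Subgroup.comap_comap,
      hkerβ.comap_fitting hg hβ, comap_mk_fitting hg]
  have hK := coveringKernel_le_ker_of_comap_eq hg hM hfit
  exact ⟨QuotientGroup.lift _ θ hK, QuotientGroup.lift_surjective_of_surjective _ _ hθ _,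
    QuotientGroup.monoidHom_ext _ hγθ⟩

theorem exists_mem_autM_comp_eq [Finite G] (hg : Subgroup.closure (Set.range g) = ⊤)
    {β γ : CoveringGroup g →* Q} (hβ : Function.Surjective β) (hγ : Function.Surjective γ)
    (hkerβ : IsAllowable g β.ker) (hkerγ : IsAllowable g γ.ker) :
    ∃ α ∈ autM g, γ.comp α.toMonoidHom = β := by
  obtain ⟨α, hα, hγα⟩ := exists_surjective_endomorphism hg hβ hγ hkerβ hkerγ
  have hM : (multiplicator g).comap α = multiplicator g := calc
    (multiplicator g).comap α = ((nu Q (fClass G)).comap γ).comap α := by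
      rw [hkerγ.comap_nu hg hγ]
    _ = (nu Q (fClass G)).comap β := by rw [Subgroup.comap_comap, hγα]
    _ = multiplicator g := hkerβ.comap_nu hg hβ
  refine ⟨MulEquiv.ofBijective α (Finite.surjective_iff_bijective.1 hα), ?_, hγα⟩
  change (multiplicator g).map α = multiplicator g
  nth_rw 1 [← hM]
  exact Subgroup.map_comap_eq_self_of_surjective hα _

end Covering

end FCentral

theorem mainTheorem1 {G : Type*} [Group G] [Finite G] {n : ℕ} (g : Fin n → G)
    (hg : Subgroup.closure (Set.range g) = ⊤)
    (U₁ U₂ : Subgroup (FCentral.CoveringGroup g)) [U₁.Normal] [U₂.Normal]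
    (h₁ : FCentral.IsAllowable g U₁) (h₂ : FCentral.IsAllowable g U₂) :
    Nonempty (FCentral.CoveringGroup g ⧸ U₁ ≃* FCentral.CoveringGroup g ⧸ U₂) ↔
      ∃ α ∈ FCentral.autM g, U₁.map α.toMonoidHom = U₂ := by
  constructor
  · rintro ⟨ψ⟩
    let β := ψ.toMonoidHom.comp (QuotientGroup.mk' U₁)
    have hβ : Function.Surjective β := ψ.surjective.comp (QuotientGroup.mk'_surjective U₁)
    have hkerβ : β.ker = U₁ :=
      (MonoidHom.ker_mulEquiv_comp _ ψ).trans (QuotientGroup.ker_mk' U₁)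
    have hkerγ := QuotientGroup.ker_mk' U₂
    obtain ⟨α, hα, hcomp⟩ := FCentral.exists_mem_autM_comp_eq hg hβ
      (QuotientGroup.mk'_surjective U₂) (hkerβ.symm ▸ h₁) (hkerγ.symm ▸ h₂)
    refine ⟨α, hα, ?_⟩
    rw [← hkerβ, ← hcomp, ← MonoidHom.comap_ker, hkerγ]
    exact Subgroup.map_comap_eq_self_of_surjective α.surjective U₂
  · rintro ⟨α, -, hα⟩
    exact ⟨QuotientGroup.congr U₁ U₂ α hα⟩
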